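/- Let a fire, initially the disc of radius $A>0$ about $0$, spread in the plane at unit speed, and let a fighter of speed $V>1$ build a barrier along the boundary of the expanding fire, starting at $p_0=A$. Put $\alpha=\arccos(1/V)\in(0,\pi/2)$ and $$l_1=\frac{A}{\cos\alpha}\bigl(e^{2\pi\cot\alpha}-1\bigr),\qquad l_2=l_1e^{\alpha\cot\alpha}.$$ The barrier curve, parametrized by its length from $p_0$, is the following. On $[0,l_1]$ it is the logarithmic spiral of excentricity $\alpha$ about $0$, with polar equation $Ae^{\psi\cot\alpha}$, $0\le\psi\le 2\pi$, ending in $p_1$. On $[l_1,l_2]$ it is the logarithmic spiral of excentricity $\alpha$ about $p_0$, with polar equation $A(e^{2\pi\cot\alpha}-1)e^{\psi\cot\alpha}$, $0\le\psi\le\alpha$. From length $l_2$ on it is drawn by the outer end of a string (the free string) of positive length which is tangent to the barrier already built at its inner endpoint, wraps continuously around it, beginning at $p_0$, and whose extension beyond the outer endpoint forms the angle $\alpha$ (counterclockwise) with the tangent of the barrier there; this continues until the free string shrinks to $0$ (the barrier closes). Let $F_0(l)=A+\cos\alpha\, l$ for $l\in[0,l_1]$ and $\phi_0(l)=\cos\alpha\,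 l$ for $l\in[l_1,l_2]$, and for $j\ge 0$ $$F_{j+1}(l)=F_0(l)\Bigl(\frac{\phi_j(l_2)}{F_0(0)}-\int_0^l\frac{F_j(t)}{F_0(t)^2}\,dt\Bigr),\qquad \phi_{j+1}(l)=\phi_0(l)\Bigl(\frac{F_{j+1}(l_1)}{\phi_0(l_1)}-\int_{l_1}^l\frac{\phi_j(t)}{\phi_0(t)^2}\,dt\Bigr).$$ Write $F_j=F_j(l_1)$ and $$v=\frac{\alpha}{\sin\alpha},\qquad r=e^{\alpha\cot\alpha},\qquad w=\frac{2\pi+\alpha}{\sin\alpha},\qquad s=e^{(2\pi+\alpha)\cot\alpha}.$$ Then the following hold. 1. The $F_j(l)$ and $\phi_j(l)$ are the free string lengths: for $l\in[0,l_1]$, the barrier point at length $l$ has distance $F_0(l)$ from $0$; for $l\in[l_1,l_2]$, it has distance $\phi_0(l)$ from $p_0$. If one starts at the barrier point at length $l$ and repeatedly moves to the outer endpoint of the free string that touches the barrier in the current point, then, as long as the barrier has not closed, the $j$-th free string ($j\ge1$) has length $F_j(l)$ if $l\in[0,l_1]$, and $\phi_j(l)$ if $l\in[l_1,l_2]$.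 In particular $F_j$ is the free string length at the end of round $j$. (After the closing, $F_j$ denotes the continuation by the recursion.) 2. The generating function $F(Z)=\sum_{j\ge0}F_jZ^j$ satisfies $$\frac{F(Z)}{F_0}=\frac{e^{vZ}-rZ}{e^{wZ}-sZ}$$ as formal power series; and on every disc $\{Z\in\mathbb C:|Z|<R\}$ in which $e^{wZ}-sZ$ has no zero, the series $\sum_j (F_j/F_0)Z^j$ converges to the right-hand side. -/

import Mathlib

open Real Set

namespace Firefighter

/-- The fighter's excentricity angle `α = arccos (1 / V)` at speed `V` (the fire has speed `1`). -/
noncomputable def angle (V : ℝ) : ℝ := arccos (1 / V)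

/-! ### The first two spiral pieces

The fire is initially the disc of radius `A` about `0`, and the barrier starts at `p₀ = A`. -/

/-- Length of the barrier from `p₀` to `p₁` (one full turn of a logarithmic spiral about `0`). -/
noncomputable def len₁ (α A : ℝ) : ℝ := A / cos α * (exp (2 * π * cot α) - 1)

/-- Length of the barrier from `p₀` to `p₂` (`p₁` to `p₂` is a piece, of angle `α`, of a
logarithmic spiral about `p₀`). -/
noncomputable def len₂ (α A : ℝ) : ℝ := A / cos α * (exp (2 * π * cot α) - 1) * exp (α * cot α)

/-! ### The free strings -/

/-- `F₀ l`: distance from `0` to the barrier point at length `l ∈ [0, l₁]`. -/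
noncomputable def F₀ (α A l : ℝ) : ℝ := A + cos α * l

/-- `φ₀ l`: distance from `p₀` to the barrier point at length `l ∈ [l₁, l₂]`. -/
noncomputable def φ₀ (α l : ℝ) : ℝ := cos α * l

/-- The pair `(F_{j+1}, φ_{j+1})` computed from `(F_j, φ_j)`. -/
noncomputable def next (α A : ℝ) (p : (ℝ → ℝ) × (ℝ → ℝ)) : (ℝ → ℝ) × (ℝ → ℝ) :=
  let F' : ℝ → ℝ := fun l =>
    F₀ α A l * (p.2 (len₂ α A) / F₀ α A 0 - ∫ t in (0 : ℝ)..l, p.1 t / F₀ α A t ^ 2)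
  let φ' : ℝ → ℝ := fun l =>
    φ₀ α l * (F' (len₁ α A) / φ₀ α (len₁ α A) - ∫ t in (len₁ α A)..l, p.2 t / φ₀ α t ^ 2)
  (F', φ')

/-- The pair `(F_j, φ_j)`. -/
noncomputable def strings (α A : ℝ) : ℕ → (ℝ → ℝ) × (ℝ → ℝ)
  | 0 => (F₀ α A, φ₀ α)
  | j + 1 => next α A (strings α A j)

/-- The free string length `F_j(l)`, `l ∈ [0, l₁]`, of the linkages anchored at `0`
(signed once the barrier has closed). -/
noncomputable def F (α A : ℝ) (j : ℕ) (l : ℝ) : ℝ := (strings α A j).1 l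

/-- The free string length `φ_j(l)`, `l ∈ [l₁, l₂]`, of the linkages anchored at `p₀`
(signed once the barrier has closed). -/
noncomputable def φ (α A : ℝ) (j : ℕ) (l : ℝ) : ℝ := (strings α A j).2 l

theorem F_zero (α A l : ℝ) : F α A 0 l = A + cos α * l := rfl

theorem φ_zero (α A l : ℝ) : φ α A 0 l = cos α * l := rfl

theorem F_succ (α A : ℝ) (j : ℕ) (l : ℝ) :
    F α A (j + 1) l = F α A 0 l *
      (φ α A j (len₂ α A) / F α A 0 0 - ∫ t in (0 : ℝ)..l, F α A j t / F α A 0 t ^ 2) := rfl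

theorem φ_succ (α A : ℝ) (j : ℕ) (l : ℝ) :
    φ α A (j + 1) l = φ α A 0 l *
      (F α A (j + 1) (len₁ α A) / φ α A 0 (len₁ α A)
        - ∫ t in (len₁ α A)..l, φ α A j t / φ α A 0 t ^ 2) := rfl

/-- The free string length `F_j = F_j(l₁)` at the end of round `j`. -/
noncomputable def roundEnd (α A : ℝ) (j : ℕ) : ℝ := F α A j (len₁ α A)

/-! ### The barrier curve

`γ L` is the barrier point at curve length `L`, `T L` the unit tangent there, and, for `L ≥ l₂`,
`τ L` is the curve length at which the free string ending in `γ L` touches the previous coil. -/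

/-- `γ` on `[0, M]` is an initial part of length `M` of the barrier curve built, at speed
`1 / cos α`, along the boundary of the expanding fire, and the free string has not shrunk to `0`
on it. -/
structure IsBarrier (α A M : ℝ) (γ T : ℝ → ℂ) (τ : ℝ → ℝ) : Prop where
  len₂_le : len₂ α A ≤ M
  hasDeriv : ∀ L ∈ Icc 0 M, HasDerivWithinAt γ (T L) (Icc 0 M) L
  unit_speed : ∀ L ∈ Icc 0 M, ‖T L‖ = 1
  continuousOn_tangent : ContinuousOn T (Icc 0 M)
  /-- From `p₀` to `p₁`: a logarithmic spiral about `0`, in polar coordinates. -/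
  spiral₀ : ∀ ψ ∈ Icc 0 (2 * π),
    γ (A / cos α * (exp (ψ * cot α) - 1)) =
      ((A * exp (ψ * cot α) : ℝ) : ℂ) * Complex.exp (ψ * Complex.I)
  /-- From `p₁` to `p₂`: a logarithmic spiral about `p₀`, in polar coordinates. -/
  spiral₁ : ∀ ψ ∈ Icc 0 α,
    γ (len₁ α A * exp (ψ * cot α)) =
      (A : ℂ) + ((A * (exp (2 * π * cot α) - 1) * exp (ψ * cot α) : ℝ) : ℂ)
        * Complex.exp (ψ * Complex.I)
  /-- From `p₂` on the string wraps around the barrier, beginning at `p₀`. -/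
  wrap_start : τ (len₂ α A) = 0
  wrap_continuous : ContinuousOn τ (Icc (len₂ α A) M)
  wrap_mono : MonotoneOn τ (Icc (len₂ α A) M)
  /-- The free string has positive length. -/
  not_closed : ∀ L ∈ Icc (len₂ α A) M, γ L ≠ γ (τ L)
  /-- The free string is tangent to the barrier at its inner endpoint. -/
  tangent : ∀ L ∈ Icc (len₂ α A) M, γ L - γ (τ L) = (‖γ L - γ (τ L)‖ : ℂ) * T (τ L)
  /-- At its outer endpoint the extended string forms the angle `α` with the barrier's tangent. -/
  angle : ∀ L ∈ Icc (len₂ α A) M, T L = Complex.exp (α * Complex.I) * T (τ L)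

/-- `ℓ 0, …, ℓ n` are the curve lengths at consecutive joints of a linkage: for `i < n` the free
string ending in `γ (ℓ (i + 1))` touches the barrier in `γ (ℓ i)`. -/
def IsLinkage (α A M : ℝ) (τ : ℝ → ℝ) (ℓ : ℕ → ℝ) (n : ℕ) : Prop :=
  ∀ i < n, ℓ (i + 1) ∈ Icc (len₂ α A) M ∧ τ (ℓ (i + 1)) = ℓ i

/-! ### The parameters of the generating function -/

noncomputable def v (α : ℝ) : ℝ := α / sin α
noncomputable def r (α : ℝ) : ℝ := exp (α * cot α)
noncomputable def w (α : ℝ) : ℝ := (2 * π + α) / sin α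
noncomputable def s (α : ℝ) : ℝ := exp ((2 * π + α) * cot α)

end Firefighter

/-!
The theorem has a geometric half, that the recursion computes the free string lengths, and an
analytic half, that the recursion has the stated generating function.

Geometry. Follow a linkage from the barrier point at length `l`, with joints at the curve lengths
`L₀ = l, L₁, L₂, …` and string lengths `f₁, f₂, …`. On its first two pieces the barrier is a spiral,
whose tangent turns in `l` at the rate `sin α / q`, where `q` is the distance from the centre of the
spiral and `q' = cos α`. All strings make fixed angles with one another, so they all turn at this
rate. Comparing the components of the velocities of the two ends of a string, normal to it and along
it, gives `Lⱼ₊₁' = fⱼ₊₁ / q` and `fⱼ₊₁' = cos α Lⱼ₊₁' - Lⱼ'`, hence `(fⱼ₊₁ / q)' = -fⱼ / q²` with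
`f₀ = q`; integrating gives the recursion. That the map `σ` from inner to outer ends exists and is
differentiable along the linkage is not assumed: `τ` is strictly monotone because a barrier built
while `τ` stands still would run along a straight string (`IsBarrier.strictMonoOn_tau`), its inverse
is continuous, and differentiability comes out of `hasDerivWithinAt_outer`. The initial values
match because the linkage starting at `0` is the one starting at `l₂` preceded by the string
`p₀ p₂`, and the two pieces share the point `p₁`.

Analysis. In the variable `x = log (q / q a) / cos α` the quotients `gⱼ` of the strings by `q`
satisfy `gⱼ₊₁' = -gⱼ`, so their generating function is its initial value times `exp (-x Z)`
(`eq_mul_expConv_of_integral_recursion`). The variable runs through an interval of length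
`2π / sin α` on the first piece and `α / sin α` on the second. The initial value on each piece is
expressed by the final value on the other one, and eliminating the second piece gives the identity
of power series (`mk_roundEnd_mul`). On a disc where the denominator has no zero the quotient is
holomorphic and is therefore the sum of this power series (`hasSum_quotient_of_ne_zero`).
-/

namespace Firefighter

/-! ### Power series -/

/-- The power series quotient `m / d` converges to the quotient of the sums on every disc about `0`
in which the denominator has no zero: the quotient is holomorphic there, so it is the sum of its
Taylor series, and multiplying out identifies the Taylor coefficients with those of `m / d`. -/
theorem hasSum_quotient_of_ne_zero {h d m : ℕ → ℂ} {D N : ℂ → ℂ}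
    (hD : ∀ z, HasSum (fun k => d k * z ^ k) (D z)) (hDd : Differentiable ℂ D)
    (hN : ∀ z, HasSum (fun k => m k * z ^ k) (N z)) (hNd : Differentiable ℂ N)
    (hmul : PowerSeries.mk h * PowerSeries.mk d = PowerSeries.mk m) {R : ℝ}
    (hne : ∀ u : ℂ, ‖u‖ < R → D u ≠ 0) {Z : ℂ} (hZ : ‖Z‖ < R) :
    HasSum (fun k => h k * Z ^ k) (N Z / D Z) := by
  have hR : 0 < R := (norm_nonneg Z).trans_lt hZ
  set f : ℂ → ℂ := fun z => N z / D z with hf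
  have hfd : DifferentiableOn ℂ f (Metric.ball 0 R) := fun z hz =>
    (hNd.differentiableAt.div hDd.differentiableAt
      (hne z (mem_ball_zero_iff.1 hz))).differentiableWithinAt
  set p : ℕ → ℂ := fun n => (n.factorial : ℂ)⁻¹ * iteratedDeriv n f 0 with hp
  have hsum : ∀ z : ℂ, ‖z‖ < R → HasSum (fun n => p n * z ^ n) (f z) := by
    intro z hz
    have := Complex.hasSum_taylorSeries_on_ball hfd (mem_ball_zero_iff.2 hz)
    simp only [sub_zero, smul_eq_mul] at this
    exact this.congr_fun fun n => by simp only [hp]; ring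
  have hprod : ∀ z : ℂ, ‖z‖ < R →
      HasSum (fun n => PowerSeries.coeff n (PowerSeries.mk p * PowerSeries.mk d) * z ^ n)
        (N z) := by
    intro z hz
    have h1 := (hsum z hz).summable.norm
    have h2 := (hD z).summable.norm
    have h3 := (summable_norm_sum_mul_antidiagonal_of_summable_norm h1 h2).of_norm.hasSum
    rw [← tsum_mul_tsum_eq_tsum_sum_antidiagonal_of_summable_norm h1 h2, (hsum z hz).tsum_eq,
      (hD z).tsum_eq, hf, div_mul_cancel₀ _ (hne z hz)] at h3
    refine h3.congr_fun fun n => ?_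
    rw [PowerSeries.coeff_mul, Finset.sum_mul]
    refine Finset.sum_congr rfl fun x hx => ?_
    rw [← Finset.HasAntidiagonal.mem_antidiagonal.1 hx, PowerSeries.coeff_mk,
      PowerSeries.coeff_mk, pow_add]
    ring
  have hcoeff : PowerSeries.mk p * PowerSeries.mk d = PowerSeries.mk m := by
    -- Power series with the same sum near `0` have the same coefficients.
    have key : ∀ c : ℕ → ℂ, (∀ z : ℂ, ‖z‖ < R → HasSum (fun n => c n * z ^ n) (N z)) →
        HasFPowerSeriesAt N (FormalMultilinearSeries.ofScalars ℂ c) 0 := by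
      intro c hc
      rw [hasFPowerSeriesAt_iff]
      filter_upwards [Metric.ball_mem_nhds (0 : ℂ) hR] with z hz
      simpa [FormalMultilinearSeries.coeff_ofScalars, mul_comm] using
        hc z (mem_ball_zero_iff.1 hz)
    have := (key _ hprod).eq_formalMultilinearSeries (key m fun z _ => hN z)
    ext n
    simpa using congrArg (fun q => FormalMultilinearSeries.coeff q n) this
  have hd0 : PowerSeries.mk d ≠ 0 := by
    intro h0
    have hd : ∀ k, d k = 0 := fun k => by
      simpa using congrArg (PowerSeries.coeff k) h0
    refine hne 0 (by simpa using hR) ((hD 0).unique ?_)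
    simp [hd, hasSum_zero]
  have hph : PowerSeries.mk p = PowerSeries.mk h :=
    mul_right_cancel₀ hd0 (hcoeff.trans hmul.symm)
  have : p = h := funext fun n => by simpa using congrArg (PowerSeries.coeff n) hph
  exact this ▸ hsum Z hZ

/-- The coefficients of `exp (w z) - s z`. -/
noncomputable def expSubLinear (w s : ℝ) (k : ℕ) : ℝ :=
  w ^ k / k.factorial - if k = 1 then s else 0

theorem mk_expSubLinear (w s : ℝ) :
    PowerSeries.mk (expSubLinear w s) =
      PowerSeries.rescale w (PowerSeries.exp ℝ) - PowerSeries.C s * PowerSeries.X := by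
  ext k
  simp [expSubLinear, PowerSeries.coeff_exp, PowerSeries.coeff_X, div_eq_mul_inv]

theorem hasSum_expSubLinear (w s : ℝ) (z : ℂ) :
    HasSum (fun k => (expSubLinear w s k : ℂ) * z ^ k) (Complex.exp (w * z) - s * z) := by
  have h1 : HasSum (fun k : ℕ => ((k.factorial : ℂ))⁻¹ • (w * z : ℂ) ^ k)
      (Complex.exp (w * z)) := by
    rw [Complex.exp_eq_exp_ℂ]; exact NormedSpace.exp_series_hasSum_exp' (𝕂 := ℂ) _
  have h2 : HasSum (fun k : ℕ => if k = 1 then (s : ℂ) * z else 0) (s * z) :=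
    hasSum_ite_eq 1 _
  refine (h1.sub h2).congr_fun fun k => ?_
  rw [expSubLinear, smul_eq_mul, mul_pow]
  split_ifs with hk
  · subst hk; push_cast; ring
  · push_cast; ring

/-- A power series identity `h (exp (w Z) - s Z) = exp (v Z) - r Z` with real coefficients holds
for the sums on every disc in which `exp (w z) - s z` has no zero. -/
theorem hasSum_of_mul_exp_sub_linear {h : ℕ → ℝ} {v r w s : ℝ}
    (hmul : PowerSeries.mk h *
        (PowerSeries.rescale w (PowerSeries.exp ℝ) - PowerSeries.C s * PowerSeries.X) =
      PowerSeries.rescale v (PowerSeries.exp ℝ) - PowerSeries.C r * PowerSeries.X)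
    {R : ℝ} (hne : ∀ u : ℂ, ‖u‖ < R → Complex.exp (w * u) - s * u ≠ 0) {Z : ℂ} (hZ : ‖Z‖ < R) :
    HasSum (fun k => (h k : ℂ) * Z ^ k)
      ((Complex.exp (v * Z) - r * Z) / (Complex.exp (w * Z) - s * Z)) := by
  refine hasSum_quotient_of_ne_zero (h := fun k => (h k : ℂ))
    (D := fun z => Complex.exp (w * z) - s * z) (N := fun z => Complex.exp (v * z) - r * z)
    (hasSum_expSubLinear w s) (by fun_prop) (hasSum_expSubLinear v r) (by fun_prop) ?_ hne hZ
  rw [← mk_expSubLinear, ← mk_expSubLinear] at hmul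
  have := congrArg (PowerSeries.map Complex.ofRealHom) hmul
  rw [map_mul] at this
  have hmap : ∀ c : ℕ → ℝ, PowerSeries.map Complex.ofRealHom (PowerSeries.mk c) =
      PowerSeries.mk fun k => (c k : ℂ) := fun c => by ext n; simp
  rwa [hmap, hmap, hmap] at this

/-! ### The string recursion in closed form -/

theorem integral_eq_sub_of_hasDerivWithinAt_Icc {f f' : ℝ → ℝ} {a b : ℝ} (hab : a ≤ b)
    (hd : ∀ x ∈ Icc a b, HasDerivWithinAt f (f' x) (Icc a b) x)
    (hc : ContinuousOn f' (Icc a b)) : ∫ x in a..b, f' x = f b - f a := by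
  refine intervalIntegral.integral_eq_sub_of_hasDerivAt_of_le hab
    (fun x hx => (hd x hx).continuousWithinAt)
    (fun x hx => (hd x (Ioo_subset_Icc_self hx)).hasDerivAt (Icc_mem_nhds hx.1 hx.2)) ?_
  exact (uIcc_of_le hab ▸ hc).intervalIntegrable

/-- The convolution `∑ₖ pⱼ₋ₖ yᵏ / k!` of `p` with the exponential coefficients: the coefficient of
`Z ^ j` in `(∑ pᵢ Zⁱ) exp (y Z)`. -/
noncomputable def expConv (p : ℕ → ℝ) (j : ℕ) (y : ℝ) : ℝ :=
  ∑ k ∈ Finset.range (j + 1), p (j - k) * (y ^ k / k.factorial)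

theorem expConv_def (p : ℕ → ℝ) (j : ℕ) : expConv p j =
    fun y => ∑ k ∈ Finset.range (j + 1), p (j - k) * (y ^ k / k.factorial) := rfl

theorem mk_expConv (p : ℕ → ℝ) (y : ℝ) :
    PowerSeries.mk (fun j => expConv p j y) =
      PowerSeries.mk p * PowerSeries.rescale y (PowerSeries.exp ℝ) := by
  ext j
  rw [mul_comm, PowerSeries.coeff_mul, Finset.Nat.sum_antidiagonal_eq_sum_range_succ_mk,
    PowerSeries.coeff_mk, expConv]
  refine Finset.sum_congr rfl fun k _ => ?_
  simp [PowerSeries.coeff_exp, div_eq_mul_inv, mul_comm]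

theorem expConv_zero_right (p : ℕ → ℝ) (j : ℕ) : expConv p j 0 = p j := by
  rw [expConv, Finset.sum_range_succ']
  simp

theorem hasDerivAt_expConv (p : ℕ → ℝ) (j : ℕ) (y : ℝ) :
    HasDerivAt (expConv p (j + 1)) (expConv p j y) y := by
  have hk : ∀ k : ℕ, HasDerivAt (fun y : ℝ => p (j - k) * (y ^ (k + 1) / (k + 1).factorial))
      (p (j - k) * (y ^ k / k.factorial)) y := by
    intro k
    have h := ((hasDerivAt_pow (k + 1) y).div_const ((k + 1).factorial : ℝ)).const_mul (p (j - k))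
    refine h.congr_deriv ?_
    have : (k.factorial : ℝ) ≠ 0 := by positivity
    rw [Nat.factorial_succ]
    push_cast
    field_simp
  have h := (HasDerivAt.fun_sum fun k (_ : k ∈ Finset.range (j + 1)) => hk k).add_const
    (p (j + 1))
  refine h.congr_of_eventuallyEq (Filter.Eventually.of_forall fun x => ?_)
  rw [expConv, Finset.sum_range_succ']
  simp

/-- If `q` is affine with slope `c`, the recursion `Gⱼ₊₁ = q (pⱼ₊₁ - ∫ₐ Gⱼ / q²)` started from
`G₀ = q` turns, in the variable `log (q / q a) / c`, into `gⱼ₊₁' = -gⱼ` for `gⱼ = Gⱼ / q`. -/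
theorem eq_mul_expConv_of_integral_recursion {q : ℝ → ℝ} {c a b : ℝ} (hc : c ≠ 0)
    (hq : ∀ l, HasDerivAt q c l) (hpos : ∀ l ∈ Icc a b, 0 < q l) {G : ℕ → ℝ → ℝ} {p : ℕ → ℝ}
    (hG0 : ∀ l, G 0 l = q l) (hp0 : p 0 = 1)
    (hG : ∀ j l, G (j + 1) l = q l * (p (j + 1) - ∫ t in a..l, G j t / q t ^ 2)) (j : ℕ) :
    ∀ l ∈ Icc a b, G j l = q l * expConv p j (-(log (q l / q a) / c)) := by
  have hqc : Continuous q := continuous_iff_continuousAt.2 fun l => (hq l).continuousAt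
  have hy : ∀ l ∈ Icc a b, HasDerivAt (fun l => -(log (q l / q a) / c)) (-(1 / q l)) l := by
    intro l hl
    have ha := hpos a ⟨le_rfl, hl.1.trans hl.2⟩
    have hl := hpos l hl
    refine ((((hq l).div_const (q a)).log (by positivity)).div_const c).neg.congr_deriv ?_
    field_simp
  induction j with
  | zero => intro l _; simp [hG0, expConv, hp0]
  | succ j ih =>
    intro l hl
    have hsub : Icc a l ⊆ Icc a b := Icc_subset_Icc_right hl.2
    have hd : ∀ t ∈ Icc a l, HasDerivWithinAt
        (fun l => -expConv p (j + 1) (-(log (q l / q a) / c))) (G j t / q t ^ 2) (Icc a l) t := by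
      intro t ht
      have h := ((hasDerivAt_expConv p j _).comp t (hy t (hsub ht))).neg
      refine (h.congr_deriv ?_).hasDerivWithinAt
      rw [ih t (hsub ht)]
      have := hpos t (hsub ht)
      field_simp
    have hcont : ContinuousOn (fun t => G j t / q t ^ 2) (Icc a l) := by
      have h1 : ContinuousOn (G j) (Icc a l) := by
        refine ContinuousOn.congr (f := fun l => q l * expConv p j (-(log (q l / q a) / c))) ?_
          fun t ht => ih t (hsub ht)
        refine hqc.continuousOn.mul (Continuous.comp_continuousOn (g := expConv p j) ?_
          fun t ht => (hy t (hsub ht)).continuousAt.continuousWithinAt)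
        simp only [expConv_def]
        fun_prop
      exact h1.div (hqc.pow 2).continuousOn fun t ht => (pow_pos (hpos t (hsub ht)) 2).ne'
    have ha := hpos a ⟨le_rfl, hl.1.trans hl.2⟩
    rw [hG, integral_eq_sub_of_hasDerivWithinAt_Icc hl.1 hd hcont, div_self ha.ne', log_one,
      zero_div, neg_zero, expConv_zero_right]
    ring

/-! ### The generating function -/

section

variable {α A : ℝ}

theorem cos_pos_of_mem (hα : α ∈ Ioo 0 (π / 2)) : 0 < cos α :=
  cos_pos_of_mem_Ioo ⟨by linarith [hα.1, pi_pos], hα.2⟩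

theorem sin_pos_of_mem (hα : α ∈ Ioo 0 (π / 2)) : 0 < sin α :=
  sin_pos_of_pos_of_lt_pi hα.1 (by linarith [hα.2, pi_pos])

theorem cot_pos_of_mem (hα : α ∈ Ioo 0 (π / 2)) : 0 < cot α := by
  rw [cot_eq_cos_div_sin]
  exact div_pos (cos_pos_of_mem hα) (sin_pos_of_mem hα)

theorem one_lt_exp_two_pi_mul_cot (hα : α ∈ Ioo 0 (π / 2)) : 1 < exp (2 * π * cot α) :=
  one_lt_exp_iff.2 (mul_pos two_pi_pos (cot_pos_of_mem hα))

theorem len₁_pos (hα : α ∈ Ioo 0 (π / 2)) (hA : 0 < A) : 0 < len₁ α A :=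
  mul_pos (div_pos hA (cos_pos_of_mem hα)) (sub_pos.2 (one_lt_exp_two_pi_mul_cot hα))

theorem len₂_eq (α A : ℝ) : len₂ α A = len₁ α A * exp (α * cot α) := rfl

theorem len₁_lt_len₂ (hα : α ∈ Ioo 0 (π / 2)) (hA : 0 < A) : len₁ α A < len₂ α A := by
  rw [len₂_eq]
  exact lt_mul_of_one_lt_right (len₁_pos hα hA)
    (one_lt_exp_iff.2 (mul_pos hα.1 (cot_pos_of_mem hα)))

theorem len₂_pos (hα : α ∈ Ioo 0 (π / 2)) (hA : 0 < A) : 0 < len₂ α A :=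
  (len₁_pos hα hA).trans (len₁_lt_len₂ hα hA)

theorem F₀_pos (hα : α ∈ Ioo 0 (π / 2)) (hA : 0 < A) {l : ℝ} (hl : 0 ≤ l) : 0 < F₀ α A l :=
  add_pos_of_pos_of_nonneg hA (mul_nonneg (cos_pos_of_mem hα).le hl)

theorem φ₀_pos (hα : α ∈ Ioo 0 (π / 2)) {l : ℝ} (hl : 0 < l) : 0 < φ₀ α l :=
  mul_pos (cos_pos_of_mem hα) hl

theorem hasDerivAt_φ₀ (α l : ℝ) : HasDerivAt (φ₀ α) (cos α) l :=
  ((hasDerivAt_id l).const_mul (cos α)).congr_deriv (mul_one _)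

theorem hasDerivAt_F₀ (α A l : ℝ) : HasDerivAt (F₀ α A) (cos α) l :=
  (hasDerivAt_φ₀ α l).const_add A

theorem F₀_zero (α A : ℝ) : F₀ α A 0 = A := by simp [F₀]

theorem F₀_len₁ (hα : α ∈ Ioo 0 (π / 2)) : F₀ α A (len₁ α A) = A * exp (2 * π * cot α) := by
  have := (cos_pos_of_mem hα).ne'
  rw [F₀, len₁]
  field_simp
  ring

theorem φ₀_len₁ (hα : α ∈ Ioo 0 (π / 2)) :
    φ₀ α (len₁ α A) = A * (exp (2 * π * cot α) - 1) := by
  have := (cos_pos_of_mem hα).ne'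
  rw [φ₀, len₁]
  field_simp

theorem φ₀_len₂ (hα : α ∈ Ioo 0 (π / 2)) :
    φ₀ α (len₂ α A) = A * (exp (2 * π * cot α) - 1) * exp (α * cot α) := by
  rw [len₂_eq, φ₀, ← mul_assoc, ← φ₀, φ₀_len₁ hα]

theorem F_zero_eq (α A l : ℝ) : F α A 0 l = F₀ α A l := rfl

theorem φ_zero_eq (α A l : ℝ) : φ α A 0 l = φ₀ α l := rfl

theorem F_apply_zero (hA : 0 < A) (j : ℕ) : F α A (j + 1) 0 = φ α A j (len₂ α A) := by
  rw [F_succ, intervalIntegral.integral_same, sub_zero, F_zero_eq, F₀_zero]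
  field_simp

theorem φ_apply_len₁ (hα : α ∈ Ioo 0 (π / 2)) (hA : 0 < A) (j : ℕ) :
    φ α A (j + 1) (len₁ α A) = F α A (j + 1) (len₁ α A) := by
  rw [φ_succ, intervalIntegral.integral_same, sub_zero, φ_zero_eq,
    mul_div_cancel₀ _ (φ₀_pos hα (len₁_pos hα hA)).ne']

theorem mul_cot_div_cos (hα : α ∈ Ioo 0 (π / 2)) (x : ℝ) : x * cot α / cos α = x / sin α := by
  have := (cos_pos_of_mem hα).ne'
  rw [cot_eq_cos_div_sin]
  field_simp

/-- The first piece in the variable `log (F₀ l / A) / cos α`, which is `2π / sin α` at `l₁`. -/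
theorem roundEnd_div_eq_expConv (hα : α ∈ Ioo 0 (π / 2)) (hA : 0 < A) (j : ℕ) :
    roundEnd α A j / roundEnd α A 0 =
      expConv (fun i => F α A i 0 / A) j (-(2 * π / sin α)) := by
  have h := eq_mul_expConv_of_integral_recursion (cos_pos_of_mem hα).ne' (hasDerivAt_F₀ α A)
    (fun l (hl : l ∈ Icc 0 (len₁ α A)) => F₀_pos hα hA hl.1) (G := F α A)
    (p := fun i => F α A i 0 / A) (F_zero_eq α A) (by simp [F_zero, hA.ne'])
    (fun j l => by rw [F_succ, F_apply_zero hA, F_zero_eq α A 0, F₀_zero]; rfl) j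
    (len₁ α A) ⟨(len₁_pos hα hA).le, le_rfl⟩
  rw [roundEnd, roundEnd, h, F_zero_eq,
    mul_div_cancel_left₀ _ (F₀_pos hα hA (len₁_pos hα hA).le).ne',
    F₀_zero, F₀_len₁ hα, mul_div_cancel_left₀ _ hA.ne', log_exp, mul_cot_div_cos hα]

/-- The second piece in the variable `log (l / l₁) / cos α`, which is `α / sin α` at `l₂`. -/
theorem φ_len₂_div_eq_expConv (hα : α ∈ Ioo 0 (π / 2)) (hA : 0 < A) (j : ℕ) :
    φ α A j (len₂ α A) / φ₀ α (len₂ α A) =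
      expConv (fun i => φ α A i (len₁ α A) / φ₀ α (len₁ α A)) j (-v α) := by
  have hpos := fun l (hl : l ∈ Icc (len₁ α A) (len₂ α A)) =>
    φ₀_pos hα ((len₁_pos hα hA).trans_le hl.1)
  have h := eq_mul_expConv_of_integral_recursion (cos_pos_of_mem hα).ne' (hasDerivAt_φ₀ α)
    hpos (G := φ α A) (p := fun i => φ α A i (len₁ α A) / φ₀ α (len₁ α A)) (φ_zero_eq α A)
    (div_self (φ₀_pos hα (len₁_pos hα hA)).ne')
    (fun j l => by rw [φ_succ, φ_apply_len₁ hα hA]; rfl) j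
    (len₂ α A) ⟨(len₁_lt_len₂ hα hA).le, le_rfl⟩
  have h1 : φ₀ α (len₂ α A) / φ₀ α (len₁ α A) = exp (α * cot α) := by
    rw [len₂_eq, φ₀, ← mul_assoc, ← φ₀, mul_div_cancel_left₀ _ (φ₀_pos hα (len₁_pos hα hA)).ne']
  rw [h, mul_div_cancel_left₀ _ (hpos _ ⟨(len₁_lt_len₂ hα hA).le, le_rfl⟩).ne', h1, log_exp,
    mul_cot_div_cos hα, v]

/-- With `H`, `K` the generating functions of the final values on the two pieces, relative to the
strings of index `0`, and `P`, `Q` those of the initial values, `H = P exp (-2π Z / sin α)` and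
`K = Q exp (-v Z)`. Moreover `P` is affine in `Z K`, because `Fⱼ₊₁ 0 = φⱼ l₂`, and `Q` is affine in
`H`, because `φⱼ l₁ = Fⱼ l₁` for `j ≥ 1`. Eliminating `P`, `Q` and `K` leaves the equation
for `H`. -/
theorem mk_roundEnd_mul (hα : α ∈ Ioo 0 (π / 2)) (hA : 0 < A) :
    PowerSeries.mk (fun j => roundEnd α A j / roundEnd α A 0) *
        (PowerSeries.rescale (w α) (PowerSeries.exp ℝ) - PowerSeries.C (s α) * PowerSeries.X) =
      PowerSeries.rescale (v α) (PowerSeries.exp ℝ) - PowerSeries.C (r α) * PowerSeries.X := by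
  set E := exp (2 * π * cot α) with hE
  have hE1 : E - 1 ≠ 0 := (sub_pos.2 (one_lt_exp_two_pi_mul_cot hα)).ne'
  have hs : s α = E * r α := by rw [s, r, hE, ← exp_add]; ring_nf
  set H := PowerSeries.mk fun j => roundEnd α A j / roundEnd α A 0 with hH
  set K := PowerSeries.mk fun j => φ α A j (len₂ α A) / φ₀ α (len₂ α A) with hK
  set P := PowerSeries.mk fun i => F α A i 0 / A with hP
  set Q := PowerSeries.mk fun i => φ α A i (len₁ α A) / φ₀ α (len₁ α A) with hQ
  set e : ℝ → PowerSeries ℝ := fun y => PowerSeries.rescale y (PowerSeries.exp ℝ) with he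
  have he_add : ∀ x y, e x * e y = e (x + y) := PowerSeries.exp_mul_exp_eq_exp_add
  have he_zero : e 0 = 1 := by ext n; cases n <;> simp [he, PowerSeries.coeff_one]
  have hHP : H = P * e (-(2 * π / sin α)) := by
    rw [hP, he, ← mk_expConv, hH]; simp_rw [roundEnd_div_eq_expConv hα hA]
  have hKQ : K = Q * e (-v α) := by
    rw [hQ, he, ← mk_expConv, hK]; simp_rw [φ_len₂_div_eq_expConv hα hA]
  have hPK : P = 1 + PowerSeries.C ((E - 1) * r α) * PowerSeries.X * K := by
    ext n
    cases n with
    | zero => simp [hP, F_zero, hA.ne', mul_assoc]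
    | succ n =>
      rw [hP, PowerSeries.coeff_mk, F_apply_zero hA, mul_assoc, map_add, PowerSeries.coeff_C_mul,
        PowerSeries.coeff_succ_X_mul, hK, PowerSeries.coeff_mk, φ₀_len₂ hα, ← r, ← hE,
        PowerSeries.coeff_one, if_neg n.succ_ne_zero, zero_add]
      have : r α ≠ 0 := (exp_pos _).ne'
      field_simp
  have hQH : Q = 1 + PowerSeries.C (E / (E - 1)) * (H - 1) := by
    ext n
    have hF := (F₀_pos hα hA (len₁_pos hα hA).le).ne'
    have hφ := (φ₀_pos hα (len₁_pos hα hA)).ne'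
    cases n with
    | zero => simp [hQ, hH, roundEnd, F_zero_eq, φ_zero_eq, hF, hφ]
    | succ n =>
      rw [hQ, PowerSeries.coeff_mk, φ_apply_len₁ hα hA, map_add, PowerSeries.coeff_C_mul, map_sub,
        hH, PowerSeries.coeff_mk, PowerSeries.coeff_one, if_neg n.succ_ne_zero, zero_add, sub_zero,
        roundEnd, roundEnd, F_zero_eq, F₀_len₁ hα, φ₀_len₁ hα, ← hE]
      have : E ≠ 0 := (exp_pos _).ne'
      field_simp
  have hw : w α = 2 * π / sin α + v α := by rw [w, v, add_div]
  have hHe : H * e (w α) = P * e (v α) := by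
    rw [hHP, mul_assoc, he_add, hw, neg_add_cancel_left]
  have hKe : K * e (v α) = Q := by
    rw [hKQ, mul_assoc, he_add, neg_add_cancel, he_zero, mul_one]
  have hC : PowerSeries.C ((E - 1) * r α) * PowerSeries.C (E / (E - 1)) = PowerSeries.C (s α) := by
    rw [← map_mul, hs]
    congr 1
    field_simp
  have hC' : PowerSeries.C ((E - 1) * r α) = PowerSeries.C (s α) - PowerSeries.C (r α) := by
    rw [← map_sub, hs]
    congr 1
    ring
  calc H * (e (w α) - PowerSeries.C (s α) * PowerSeries.X)
      = e (v α) + PowerSeries.C ((E - 1) * r α) * PowerSeries.X * (K * e (v α))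
          - PowerSeries.C (s α) * PowerSeries.X * H := by
        rw [mul_sub, hHe, hPK]; ring
    _ = e (v α) + PowerSeries.C ((E - 1) * r α) * PowerSeries.X
          + (PowerSeries.C ((E - 1) * r α) * PowerSeries.C (E / (E - 1))) * PowerSeries.X * (H - 1)
          - PowerSeries.C (s α) * PowerSeries.X * H := by
        rw [hKe, hQH]; ring
    _ = e (v α) - PowerSeries.C (r α) * PowerSeries.X := by rw [hC, hC']; ring

end

/-! ### Motion of the outer endpoint of a free string -/

open Filter Topology in
/-- The string from `γ (P y)` to `γ (Q y)` has length `g y` and direction `u y`. If the inner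
endpoint moves along `γ` with velocity `P'` while the direction turns at rate `κ`, and the curve
leaves the outer endpoint at the angle `α` with the string, then the outer endpoint moves with
velocity `g κ / sin α`. Differentiability of `Q` is part of the conclusion: it comes from comparing
the components normal to the string of the increments of `γ ∘ Q` and `γ ∘ P`. -/
theorem hasDerivWithinAt_outer {γ : ℝ → ℂ} {J S : Set ℝ} {P Q g : ℝ → ℝ} {u : ℝ → ℂ}
    {x α κ P' : ℝ} (hx : x ∈ S) (hP : HasDerivWithinAt P P' S x) (hPJ : MapsTo P S J)
    (hQJ : MapsTo Q S J) (hu : HasDerivWithinAt u (Complex.I * κ * u x) S x)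
    (hu0 : ∀ y ∈ S, u y ≠ 0) (hγP : HasDerivWithinAt γ (u x) J (P x))
    (hγQ : HasDerivWithinAt γ (Complex.exp (α * Complex.I) * u x) J (Q x))
    (hQc : ContinuousWithinAt Q S x) (hQi : ∀ y ∈ S, y ≠ x → Q y ≠ Q x)
    (hg : ∀ y ∈ S, γ (Q y) - γ (P y) = g y * u y) (hsin : sin α ≠ 0) :
    HasDerivWithinAt Q (g x * κ / sin α) S x ∧
      HasDerivWithinAt g (cos α * (g x * κ / sin α) - P') S x := by
  have hux := hu0 x hx
  have hγP' : HasDerivWithinAt (fun y => γ (P y)) (P' • u x) S x :=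
    HasDerivWithinAt.scomp x hγP hP hPJ
  have hQ : HasDerivWithinAt Q (g x * κ / sin α) S x := by
    have hb : HasDerivWithinAt (fun y => ((γ (P y) - γ (Q x)) / u y).im) (g x * κ) S x := by
      have h := Complex.imCLM.hasFDerivAt.comp_hasDerivWithinAt x
        ((hγP'.sub_const (γ (Q x))).div hu hux)
      refine h.congr_deriv ?_
      have e : γ (P x) - γ (Q x) = -(g x * u x) := by rw [← hg x hx]; ring
      have e2 : (P' • u x * u x - (γ (P x) - γ (Q x)) * (Complex.I * κ * u x)) / u x ^ 2 =
          P' + (g x * κ : ℝ) * Complex.I := by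
        rw [e, Complex.real_smul]
        push_cast
        field_simp
        ring
      rw [e2]
      simp
    -- The string direction is the real axis of `· / u y`, so the outer endpoint may replace the
    -- inner one in the imaginary part.
    have hab : ∀ y ∈ S, ((γ (P y) - γ (Q x)) / u y).im = ((γ (Q y) - γ (Q x)) / u y).im := by
      intro y hy
      have : (γ (Q y) - γ (Q x)) / u y = (γ (P y) - γ (Q x)) / u y + g y := by
        have := hu0 y hy
        field_simp
        linear_combination hg y hy
      rw [this]
      simp
    rw [hasDerivWithinAt_iff_tendsto_slope] at hb hγQ ⊢
    have hQt : Tendsto Q (𝓝[S \ {x}] x) (𝓝[J \ {Q x}] (Q x)) :=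
      tendsto_nhdsWithin_iff.2 ⟨hQc.tendsto.mono_left (nhdsWithin_mono _ sdiff_subset),
        eventually_nhdsWithin_of_forall fun y hy => ⟨hQJ hy.1, hQi y hy.1 hy.2⟩⟩
    have hut : Tendsto u (𝓝[S \ {x}] x) (𝓝 (u x)) :=
      hu.continuousWithinAt.tendsto.mono_left (nhdsWithin_mono _ sdiff_subset)
    have ha : Tendsto (fun y => (slope γ (Q x) (Q y) / u y).im) (𝓝[S \ {x}] x) (𝓝 (sin α)) := by
      have h := (Complex.continuous_im.tendsto _).comp ((hγQ.comp hQt).div hut hux)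
      rw [mul_div_cancel_right₀ _ hux, Complex.exp_ofReal_mul_I_im] at h
      exact h
    refine (hb.div ha hsin).congr' ?_
    filter_upwards [ha.eventually_ne hsin, self_mem_nhdsWithin] with y hy0 hyS
    have hQy : Q y - Q x ≠ 0 := sub_ne_zero.2 (hQi y hyS.1 hyS.2)
    have hyx : y - x ≠ 0 := sub_ne_zero.2 hyS.2
    have e1 : (slope γ (Q x) (Q y) / u y).im =
        ((γ (Q y) - γ (Q x)) / u y).im / (Q y - Q x) := by
      rw [slope_def_module, smul_div_assoc, Complex.smul_im, smul_eq_mul, inv_mul_eq_div]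
    rw [e1] at hy0
    have hy1 := (div_ne_zero_iff.1 hy0).1
    have e0 : ((γ (P x) - γ (Q x)) / u x).im = 0 := by rw [hab x hx]; simp
    rw [Pi.div_apply, e1, slope_def_field, slope_def_field, e0, hab y hyS.1, sub_zero]
    field_simp
  refine ⟨hQ, ?_⟩
  have hγQ' := HasDerivWithinAt.scomp x hγQ hQ hQJ
  have h := Complex.reCLM.hasFDerivAt.comp_hasDerivWithinAt x ((hγQ'.sub hγP').div hu hux)
  refine (h.congr_deriv ?_).congr (fun y hy => ?_) ?_
  · have e : (γ ∘ Q) x - γ (P x) = g x * u x := hg x hx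
    have e2 : (((g x * κ / sin α) • (Complex.exp (α * Complex.I) * u x) - P' • u x) * u x -
        ((γ ∘ Q) x - γ (P x)) * (Complex.I * κ * u x)) / u x ^ 2 =
        (g x * κ / sin α : ℝ) * Complex.exp (α * Complex.I) - P'
          - (g x * κ : ℝ) * Complex.I := by
      rw [e, Complex.real_smul, Complex.real_smul]
      push_cast
      field_simp
    simp only [Pi.sub_apply, Function.comp_apply] at e2 ⊢
    rw [e2, Complex.reCLM_apply, Complex.sub_re, Complex.sub_re, Complex.re_ofReal_mul,
      Complex.exp_ofReal_mul_I_re, Complex.re_ofReal_mul, Complex.I_re, Complex.ofReal_re]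
    ring
  · have := hu0 y hy
    simp [hg y hy, this]
  · simp [hg x hx, hux]

/-- Along a logarithmic spiral of excentricity `α` about `p`, parametrized by length, so that the
distance `q` from `p` grows at rate `cos α`, the tangent turns at the rate `sin α / q`. -/
theorem hasDerivWithinAt_tangent_of_spiral {γ T : ℝ → ℂ} {q : ℝ → ℝ} {a b α : ℝ} {p : ℂ}
    (hab : a < b) (hcos : cos α ≠ 0) (hq : ∀ l, HasDerivAt q (cos α) l)
    (hpos : ∀ l ∈ Icc a b, 0 < q l)
    (hγ : ∀ l ∈ Icc a b, γ l = p + q l * Complex.exp ((tan α * log (q l / q a) : ℝ) * Complex.I))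
    (hT : ∀ l ∈ Icc a b, HasDerivWithinAt γ (T l) (Icc a b) l) :
    ∀ l ∈ Icc a b, HasDerivWithinAt T (Complex.I * (sin α / q l : ℝ) * T l) (Icc a b) l := by
  set ψ : ℝ → ℝ := fun l => tan α * log (q l / q a) with hψ
  have hpa := hpos a ⟨le_rfl, hab.le⟩
  have hψd : ∀ l ∈ Icc a b, HasDerivAt ψ (sin α / q l) l := by
    intro l hl
    have hl := hpos l hl
    refine ((((hq l).div_const (q a)).log (by positivity)).const_mul (tan α)).congr_deriv ?_
    rw [tan_eq_sin_div_cos]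
    field_simp
  have hexp : ∀ β : ℝ, ∀ l ∈ Icc a b,
      HasDerivAt (fun l => Complex.exp (((β + ψ l : ℝ) : ℂ) * Complex.I))
        (Complex.I * (sin α / q l : ℝ) * Complex.exp (((β + ψ l : ℝ) : ℂ) * Complex.I)) l := by
    intro β l hl
    refine ((((hψd l hl).const_add β).ofReal_comp).mul_const Complex.I).cexp.congr_deriv ?_
    ring
  have hTeq : ∀ l ∈ Icc a b, T l = Complex.exp (((α + ψ l : ℝ) : ℂ) * Complex.I) := by
    intro l hl
    have h := ((((hq l).ofReal_comp).mul (hexp 0 l hl)).const_add p).hasDerivWithinAt (s := Icc a b)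
    refine (uniqueDiffOn_Icc hab l hl).eq_deriv _ (hT l hl)
      ((h.congr (fun y hy => ?_) ?_).congr_deriv ?_)
    · simp [hγ y hy, hψ]
    · simp [hγ l hl, hψ]
    · have hq0 : (q l : ℂ) ≠ 0 := Complex.ofReal_ne_zero.2 (hpos l hl).ne'
      have e : Complex.exp (((α + ψ l : ℝ) : ℂ) * Complex.I) =
          (Complex.cos α + Complex.sin α * Complex.I) * Complex.exp ((ψ l : ℂ) * Complex.I) := by
        rw [← Complex.exp_mul_I, ← Complex.exp_add]
        push_cast
        ring_nf
      rw [e, zero_add]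
      push_cast
      field_simp
  intro l hl
  rw [hTeq l hl]
  exact (hexp α l hl).hasDerivWithinAt.congr hTeq (hTeq l hl)

/-! ### The joints of a linkage as functions of the first joint -/

/-- The curve length at which the free string touching the barrier at curve length `t` ends: the
inverse of `τ` on `[l₂, M]`. -/
noncomputable def outerEnd (α A M : ℝ) (τ : ℝ → ℝ) : ℝ → ℝ :=
  Function.invFunOn τ (Icc (len₂ α A) M)

/-- The curve lengths from which a linkage of `n` free strings can be followed within `[0, M]`. -/
def reach (α A M : ℝ) (τ : ℝ → ℝ) (n : ℕ) : Set ℝ :=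
  {l | 0 ≤ l ∧ ∀ i < n, (outerEnd α A M τ)^[i] l ≤ τ M}

/-- The length of the `j`-th free string of the linkage starting at `l`, where the distance `q` from
the centre of the spiral through `l` plays the role of the string of index `0`. -/
noncomputable def stringLen (γ : ℝ → ℂ) (σ : ℝ → ℝ) (q : ℝ → ℝ) : ℕ → ℝ → ℝ
  | 0, l => q l
  | j + 1, l => ‖γ (σ^[j + 1] l) - γ (σ^[j] l)‖

theorem mem_reach_succ {α A M : ℝ} {τ : ℝ → ℝ} {n : ℕ} {l : ℝ} :
    l ∈ reach α A M τ (n + 1) ↔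
      l ∈ reach α A M τ n ∧ (outerEnd α A M τ)^[n] l ≤ τ M := by
  simp only [reach, mem_ofPred_eq, Nat.lt_succ_iff_lt_or_eq, or_imp, forall_and, forall_eq,
    and_assoc]

theorem reach_anti {α A M : ℝ} {τ : ℝ → ℝ} {m n : ℕ} (hmn : m ≤ n) :
    reach α A M τ n ⊆ reach α A M τ m :=
  fun _ hl => ⟨hl.1, fun i hi => hl.2 i (hi.trans_le hmn)⟩

namespace IsBarrier

variable {α A M : ℝ} {γ T : ℝ → ℂ} {τ : ℝ → ℝ}

/-- The string cannot be wrapped off beyond the point that is being built: `τ L = L` would mean that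
the barrier has closed. -/
theorem tau_lt (h : IsBarrier α A M γ T τ) (hα : α ∈ Ioo 0 (π / 2)) (hA : 0 < A) {L : ℝ}
    (hL : L ∈ Icc (len₂ α A) M) : τ L < L := by
  by_contra! hlt
  have hsub : Icc (len₂ α A) L ⊆ Icc (len₂ α A) M := Icc_subset_Icc_right hL.2
  obtain ⟨c, hc, hc0⟩ := intermediate_value_Icc hL.1
    ((h.wrap_continuous.mono hsub).sub continuousOn_id)
    (show (0 : ℝ) ∈ _ from ⟨by simp [h.wrap_start, (len₂_pos hα hA).le], by simpa using hlt⟩)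
  have hcc : τ c = c := sub_eq_zero.1 hc0
  exact h.not_closed c (hsub hc) (by rw [hcc])

theorem tau_nonneg (h : IsBarrier α A M γ T τ) {L : ℝ} (hL : L ∈ Icc (len₂ α A) M) : 0 ≤ τ L :=
  h.wrap_start ▸ h.wrap_mono ⟨le_rfl, h.len₂_le⟩ hL hL.1

theorem tau_mem (h : IsBarrier α A M γ T τ) (hα : α ∈ Ioo 0 (π / 2)) (hA : 0 < A) {L : ℝ}
    (hL : L ∈ Icc (len₂ α A) M) : τ L ∈ Icc 0 M :=
  ⟨h.tau_nonneg hL, (h.tau_lt hα hA hL).le.trans hL.2⟩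

theorem T_ne_zero (h : IsBarrier α A M γ T τ) {L : ℝ} (hL : L ∈ Icc 0 M) : T L ≠ 0 :=
  norm_ne_zero_iff.1 (by simp [h.unit_speed L hL])

/-- While `τ` stands still the barrier would run along a straight string, but it makes the angle
`α ≠ 0` with the string. -/
theorem strictMonoOn_tau (h : IsBarrier α A M γ T τ) (hα : α ∈ Ioo 0 (π / 2)) (hA : 0 < A) :
    StrictMonoOn τ (Icc (len₂ α A) M) := by
  intro x hx y hy hxy
  refine lt_of_le_of_ne (h.wrap_mono hx hy hxy.le) fun heq => ?_
  have hsub : Icc x y ⊆ Icc (len₂ α A) M := Icc_subset_Icc hx.1 hy.2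
  have hconst : ∀ z ∈ Icc x y, τ z = τ x := fun z hz => le_antisymm
    (heq ▸ h.wrap_mono (hsub hz) hy hz.2) (h.wrap_mono hx (hsub hz) hz.1)
  have hT0 := h.T_ne_zero (h.tau_mem hα hA hx)
  have hzero : ∀ z ∈ Icc x y, ((γ z - γ (τ x)) / T (τ x)).im = 0 := by
    intro z hz
    have := h.tangent z (hsub hz)
    rw [hconst z hz] at this
    rw [this, mul_div_cancel_right₀ _ hT0, Complex.ofReal_im]
  have hxM : Icc x y ⊆ Icc 0 M := Icc_subset_Icc ((len₂_pos hα hA).le.trans hx.1) hy.2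
  have hxx : x ∈ Icc x y := ⟨le_rfl, hxy.le⟩
  have hd := Complex.imCLM.hasFDerivAt.comp_hasDerivWithinAt x
    ((((h.hasDeriv x (hxM hxx)).mono hxM).sub_const (γ (τ x))).div_const (T (τ x)))
  have hd0 := (hasDerivWithinAt_const x (Icc x y) (0 : ℝ)).congr hzero (hzero x hxx)
  have := (uniqueDiffOn_Icc hxy x hxx).eq_deriv _ hd hd0
  rw [h.angle x hx, mul_div_cancel_right₀ _ hT0, Complex.imCLM_apply,
    Complex.exp_ofReal_mul_I_im] at this
  exact (sin_pos_of_mem hα).ne' this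

theorem image_tau (h : IsBarrier α A M γ T τ) {t : ℝ} (ht : t ∈ Icc 0 (τ M)) :
    t ∈ τ '' Icc (len₂ α A) M :=
  intermediate_value_Icc h.len₂_le h.wrap_continuous (by rwa [h.wrap_start])

theorem outerEnd_mem (h : IsBarrier α A M γ T τ) {t : ℝ} (ht : t ∈ Icc 0 (τ M)) :
    outerEnd α A M τ t ∈ Icc (len₂ α A) M :=
  Function.invFunOn_mem (h.image_tau ht)

theorem tau_outerEnd (h : IsBarrier α A M γ T τ) {t : ℝ} (ht : t ∈ Icc 0 (τ M)) :
    τ (outerEnd α A M τ t) = t :=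
  Function.invFunOn_eq (h.image_tau ht)

theorem outerEnd_tau (h : IsBarrier α A M γ T τ) (hα : α ∈ Ioo 0 (π / 2)) (hA : 0 < A) {L : ℝ}
    (hL : L ∈ Icc (len₂ α A) M) : outerEnd α A M τ (τ L) = L :=
  (h.strictMonoOn_tau hα hA).injOn.leftInvOn_invFunOn hL

theorem outerEnd_zero (h : IsBarrier α A M γ T τ) (hα : α ∈ Ioo 0 (π / 2)) (hA : 0 < A) :
    outerEnd α A M τ 0 = len₂ α A := by
  conv_lhs => rw [← h.wrap_start]
  exact h.outerEnd_tau hα hA ⟨le_rfl, h.len₂_le⟩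

theorem strictMonoOn_outerEnd (h : IsBarrier α A M γ T τ) (hα : α ∈ Ioo 0 (π / 2)) (hA : 0 < A) :
    StrictMonoOn (outerEnd α A M τ) (Icc 0 (τ M)) := by
  intro x hx y hy hxy
  refine ((h.strictMonoOn_tau hα hA).lt_iff_lt (h.outerEnd_mem hx) (h.outerEnd_mem hy)).1 ?_
  rwa [h.tau_outerEnd hx, h.tau_outerEnd hy]

/-- The inverse of a continuous injection of a compact interval is continuous: preimages of closed
sets are images of compact sets. -/
theorem continuousOn_outerEnd (h : IsBarrier α A M γ T τ) (hα : α ∈ Ioo 0 (π / 2)) (hA : 0 < A) :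
    ContinuousOn (outerEnd α A M τ) (Icc 0 (τ M)) := by
  refine continuousOn_iff_isClosed.2 fun C hC => ⟨τ '' (Icc (len₂ α A) M ∩ C),
    ((isCompact_Icc.inter_right hC).image_of_continuousOn
      (h.wrap_continuous.mono inter_subset_left)).isClosed, ?_⟩
  ext t
  constructor
  · rintro ⟨htC, ht⟩
    exact ⟨⟨_, ⟨h.outerEnd_mem ht, htC⟩, h.tau_outerEnd ht⟩, ht⟩
  · rintro ⟨⟨L, hL, rfl⟩, ht⟩
    exact ⟨by rw [mem_preimage, h.outerEnd_tau hα hA hL.1]; exact hL.2, ht⟩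

theorem iterate_mem (h : IsBarrier α A M γ T τ) (hα : α ∈ Ioo 0 (π / 2)) (hA : 0 < A) {n : ℕ}
    {l : ℝ} (hl : l ∈ reach α A M τ (n + 1)) :
    (outerEnd α A M τ)^[n] l ∈ Icc 0 (τ M) := by
  induction n with
  | zero => exact ⟨hl.1, hl.2 0 one_pos⟩
  | succ n ih =>
    refine ⟨?_, hl.2 _ (Nat.lt_succ_self _)⟩
    rw [Function.iterate_succ_apply']
    exact (len₂_pos hα hA).le.trans (h.outerEnd_mem (ih (mem_reach_succ.1 hl).1)).1

theorem iterate_succ_mem (h : IsBarrier α A M γ T τ) (hα : α ∈ Ioo 0 (π / 2)) (hA : 0 < A)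
    {n : ℕ} {l : ℝ} (hl : l ∈ reach α A M τ (n + 1)) :
    (outerEnd α A M τ)^[n + 1] l ∈ Icc (len₂ α A) M := by
  rw [Function.iterate_succ_apply']
  exact h.outerEnd_mem (h.iterate_mem hα hA hl)

theorem strictMonoOn_iterate (h : IsBarrier α A M γ T τ) (hα : α ∈ Ioo 0 (π / 2)) (hA : 0 < A)
    (n : ℕ) : StrictMonoOn (outerEnd α A M τ)^[n] (reach α A M τ n) := by
  induction n with
  | zero => exact fun x _ y _ hxy => hxy
  | succ n ih =>
    intro x hx y hy hxy
    rw [Function.iterate_succ_apply', Function.iterate_succ_apply']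
    exact h.strictMonoOn_outerEnd hα hA (h.iterate_mem hα hA hx) (h.iterate_mem hα hA hy)
      (ih (mem_reach_succ.1 hx).1 (mem_reach_succ.1 hy).1 hxy)

theorem mem_reach_of_le (h : IsBarrier α A M γ T τ) (hα : α ∈ Ioo 0 (π / 2)) (hA : 0 < A) {n : ℕ}
    {x y : ℝ} (hx : 0 ≤ x) (hxy : x ≤ y) (hy : y ∈ reach α A M τ n) : x ∈ reach α A M τ n := by
  induction n with
  | zero => exact ⟨hx, fun i hi => absurd hi i.not_lt_zero⟩
  | succ n ih =>
    rw [mem_reach_succ] at hy ⊢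
    exact ⟨ih hy.1, ((h.strictMonoOn_iterate hα hA n).monotoneOn (ih hy.1) hy.1 hxy).trans hy.2⟩

theorem continuousOn_iterate (h : IsBarrier α A M γ T τ) (hα : α ∈ Ioo 0 (π / 2)) (hA : 0 < A)
    (n : ℕ) : ContinuousOn (outerEnd α A M τ)^[n] (reach α A M τ n) := by
  induction n with
  | zero => exact continuousOn_id
  | succ n ih =>
    rw [Function.iterate_succ']
    exact (h.continuousOn_outerEnd hα hA).comp (ih.mono (reach_anti n.le_succ))
      fun l hl => h.iterate_mem hα hA hl

/-- Consecutive strings of a linkage form the angle `α`. -/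
theorem T_iterate (h : IsBarrier α A M γ T τ) (hα : α ∈ Ioo 0 (π / 2)) (hA : 0 < A) {n : ℕ}
    {l : ℝ} (hl : l ∈ reach α A M τ n) :
    T ((outerEnd α A M τ)^[n] l) = Complex.exp (α * Complex.I) ^ n * T l := by
  induction n with
  | zero => simp
  | succ n ih =>
    have hmem := h.iterate_mem hα hA hl
    rw [Function.iterate_succ_apply', h.angle _ (h.outerEnd_mem hmem), h.tau_outerEnd hmem,
      ih (mem_reach_succ.1 hl).1]
    ring

theorem iterate_eq_of_isLinkage (h : IsBarrier α A M γ T τ) (hα : α ∈ Ioo 0 (π / 2)) (hA : 0 < A)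
    {ℓ : ℕ → ℝ} {n : ℕ} (hℓ : IsLinkage α A M τ ℓ n) :
    ∀ i ≤ n, (outerEnd α A M τ)^[i] (ℓ 0) = ℓ i := by
  intro i
  induction i with
  | zero => simp
  | succ i ih =>
    intro hi
    rw [Function.iterate_succ_apply', ih (by omega), ← (hℓ i hi).2,
      h.outerEnd_tau hα hA (hℓ i hi).1]

theorem mem_reach_of_isLinkage (h : IsBarrier α A M γ T τ) (hα : α ∈ Ioo 0 (π / 2)) (hA : 0 < A)
    {ℓ : ℕ → ℝ} {n : ℕ} (hℓ : IsLinkage α A M τ ℓ n) (h0 : 0 ≤ ℓ 0) :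
    ℓ 0 ∈ reach α A M τ n := by
  refine ⟨h0, fun i hi => ?_⟩
  rw [h.iterate_eq_of_isLinkage hα hA hℓ i hi.le, ← (hℓ i hi).2]
  exact h.wrap_mono (hℓ i hi).1 ⟨h.len₂_le, le_rfl⟩ (hℓ i hi).1.2

/-! ### The differential equation of the string lengths -/

/-- If the barrier turns at rate `sin α / q` at the first joint `l`, all strings of the linkage turn
at this rate, so the joint `j + 1` moves with velocity `stringLen (j + 1) / q` in `l`. -/
theorem hasDerivWithinAt_iterate_and_stringLen (h : IsBarrier α A M γ T τ)
    (hα : α ∈ Ioo 0 (π / 2)) (hA : 0 < A) {q : ℝ → ℝ} {a b : ℝ} {n : ℕ} (ha : 0 ≤ a) (hbM : b ≤ M)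
    (hb : b ∈ reach α A M τ n) (hpos : ∀ l ∈ Icc a b, 0 < q l)
    (hT : ∀ l ∈ Icc a b,
      HasDerivWithinAt T (Complex.I * (sin α / q l : ℝ) * T l) (Icc a b) l) :
    ∀ j < n, ∀ l ∈ Icc a b,
      HasDerivWithinAt (outerEnd α A M τ)^[j]
        (stringLen γ (outerEnd α A M τ) q j l / q l) (Icc a b) l ∧
      HasDerivWithinAt (stringLen γ (outerEnd α A M τ) q (j + 1))
        (cos α * (stringLen γ (outerEnd α A M τ) q (j + 1) l / q l) -
          stringLen γ (outerEnd α A M τ) q j l / q l) (Icc a b) l := by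
  set σ := outerEnd α A M τ with hσ
  have hreach : ∀ m ≤ n, ∀ l ∈ Icc a b, l ∈ reach α A M τ m := fun m hm l hl =>
    h.mem_reach_of_le hα hA (ha.trans hl.1) hl.2 (reach_anti hm hb)
  have hmaps : ∀ m ≤ n, MapsTo σ^[m] (Icc a b) (Icc 0 M) := by
    intro m hm l hl
    cases m with
    | zero => exact ⟨ha.trans hl.1, hl.2.trans hbM⟩
    | succ m =>
      exact Icc_subset_Icc_left (len₂_pos hα hA).le
        (h.iterate_succ_mem hα hA (hreach _ hm l hl))
  have hsin := (sin_pos_of_mem hα).ne'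
  -- One step along the linkage.
  have step : ∀ j < n, ∀ l ∈ Icc a b,
      HasDerivWithinAt σ^[j] (stringLen γ σ q j l / q l) (Icc a b) l →
      HasDerivWithinAt σ^[j + 1] (stringLen γ σ q (j + 1) l / q l) (Icc a b) l ∧
      HasDerivWithinAt (stringLen γ σ q (j + 1))
        (cos α * (stringLen γ σ q (j + 1) l / q l) - stringLen γ σ q j l / q l)
        (Icc a b) l := by
    intro j hj l hl hP
    have hTj : ∀ y ∈ Icc a b, T (σ^[j] y) = Complex.exp (α * Complex.I) ^ j * T y :=
      fun y hy => h.T_iterate hα hA (hreach j hj.le y hy)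
    have hu : HasDerivWithinAt (fun y => T (σ^[j] y))
        (Complex.I * (sin α / q l : ℝ) * T (σ^[j] l)) (Icc a b) l := by
      refine (((hT l hl).const_mul (Complex.exp (α * Complex.I) ^ j)).congr hTj
        (hTj l hl)).congr_deriv ?_
      rw [hTj l hl]
      ring
    have hmemj := fun y hy => h.iterate_mem hα hA (hreach (j + 1) hj y hy)
    have hγQ : HasDerivWithinAt γ (Complex.exp (α * Complex.I) * T (σ^[j] l)) (Icc 0 M)
        (σ^[j + 1] l) := by
      have := h.hasDeriv _ (hmaps (j + 1) hj hl)
      rwa [Function.iterate_succ_apply', h.angle _ (h.outerEnd_mem (hmemj l hl)),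
        h.tau_outerEnd (hmemj l hl), ← Function.iterate_succ_apply' σ] at this
    have hg : ∀ y ∈ Icc a b, γ (σ^[j + 1] y) - γ (σ^[j] y) =
        (stringLen γ σ q (j + 1) y : ℂ) * T (σ^[j] y) := by
      intro y hy
      have := h.tangent _ (h.outerEnd_mem (hmemj y hy))
      rwa [h.tau_outerEnd (hmemj y hy), ← hσ, ← Function.iterate_succ_apply' σ] at this
    obtain ⟨h1, h2⟩ := hasDerivWithinAt_outer hl hP (hmaps j hj.le) (hmaps (j + 1) hj) hu
      (fun y hy => h.T_ne_zero (hmaps j hj.le hy)) (h.hasDeriv _ (hmaps j hj.le hl)) hγQ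
      (((h.continuousOn_iterate hα hA (j + 1)).mono (hreach (j + 1) hj)) l hl)
      (fun y hy hne => (h.strictMonoOn_iterate hα hA (j + 1)).injOn.ne
        (hreach (j + 1) hj y hy) (hreach (j + 1) hj l hl) hne) hg hsin
    have e : stringLen γ σ q (j + 1) l * (sin α / q l) / sin α =
        stringLen γ σ q (j + 1) l / q l := by
      field_simp
    rw [e] at h1 h2
    exact ⟨h1, h2⟩
  have hiter : ∀ j ≤ n, ∀ l ∈ Icc a b,
      HasDerivWithinAt σ^[j] (stringLen γ σ q j l / q l) (Icc a b) l := by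
    intro j
    induction j with
    | zero =>
      intro _ l hl
      exact (hasDerivWithinAt_id l _).congr_deriv (div_self (hpos l hl).ne').symm
    | succ j ih => exact fun hj l hl => (step j hj l hl (ih (by omega) l hl)).1
  exact fun j hj l hl => ⟨hiter j hj.le l hl, (step j hj l hl (hiter j hj.le l hl)).2⟩

/-- The integrated form of the differential equation, `(stringLen (j + 1) / q)' =
-stringLen j / q²`. -/
theorem stringLen_succ_eq (h : IsBarrier α A M γ T τ)
    (hα : α ∈ Ioo 0 (π / 2)) (hA : 0 < A) {q : ℝ → ℝ} (hq : ∀ l, HasDerivAt q (cos α) l)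
    {a b : ℝ} {j : ℕ} (ha : 0 ≤ a) (hab : a ≤ b) (hbM : b ≤ M)
    (hb : b ∈ reach α A M τ (j + 1)) (hpos : ∀ l ∈ Icc a b, 0 < q l)
    (hT : ∀ l ∈ Icc a b,
      HasDerivWithinAt T (Complex.I * (sin α / q l : ℝ) * T l) (Icc a b) l) :
    stringLen γ (outerEnd α A M τ) q (j + 1) b =
      q b * (stringLen γ (outerEnd α A M τ) q (j + 1) a / q a -
        ∫ t in a..b, stringLen γ (outerEnd α A M τ) q j t / q t ^ 2) := by
  have hd := h.hasDerivWithinAt_iterate_and_stringLen hα hA ha hbM hb hpos hT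
  have hqc : ContinuousOn q (Icc a b) := fun l _ => (hq l).continuousAt.continuousWithinAt
  have hcont : ContinuousOn (stringLen γ (outerEnd α A M τ) q j) (Icc a b) := by
    cases j with
    | zero => exact hqc
    | succ j => exact fun l hl => (hd j (by omega) l hl).2.continuousWithinAt
  have hint := integral_eq_sub_of_hasDerivWithinAt_Icc hab
    (f := fun l => -(stringLen γ (outerEnd α A M τ) q (j + 1) l / q l))
    (f' := fun t => stringLen γ (outerEnd α A M τ) q j t / q t ^ 2) (fun l hl => by
      have hl0 := (hpos l hl).ne'
      refine ((hd j j.lt_succ_self l hl).2.div (hq l).hasDerivWithinAt hl0).neg.congr_deriv ?_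
      field_simp
      ring)
    (hcont.div (hqc.pow 2) fun t ht => (pow_pos (hpos t ht) 2).ne')
  have := (hpos b ⟨hab, le_rfl⟩).ne'
  rw [hint]
  field_simp
  ring

/-! ### The first two pieces of the barrier -/

theorem eq_on_first_piece (h : IsBarrier α A M γ T τ) (hα : α ∈ Ioo 0 (π / 2)) (hA : 0 < A) :
    ∀ l ∈ Icc 0 (len₁ α A), γ l =
      0 + F₀ α A l * Complex.exp ((tan α * log (F₀ α A l / F₀ α A 0) : ℝ) * Complex.I) := by
  intro l hl
  have hc := cos_pos_of_mem hα
  have hs := sin_pos_of_mem hα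
  have hF := F₀_pos hα hA hl.1
  have htan : 0 < tan α := tan_pos_of_pos_of_lt_pi_div_two hα.1 hα.2
  have htc : ∀ x : ℝ, tan α * x * cot α = x := fun x => by
    rw [tan_eq_sin_div_cos, cot_eq_cos_div_sin]; field_simp
  have hexp : exp (tan α * log (F₀ α A l / A) * cot α) = F₀ α A l / A := by
    rw [htc, exp_log (div_pos hF hA)]
  have hmono : A ≤ F₀ α A l := by
    have := mul_nonneg hc.le hl.1
    rw [F₀]; linarith
  have hle : F₀ α A l ≤ A * exp (2 * π * cot α) := by
    rw [← F₀_len₁ hα]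
    exact add_le_add_right (mul_le_mul_of_nonneg_left hl.2 hc.le) A
  have hψ : tan α * log (F₀ α A l / A) ∈ Icc 0 (2 * π) := by
    refine ⟨mul_nonneg htan.le (log_nonneg ((one_le_div hA).2 hmono)), ?_⟩
    have h1 : log (F₀ α A l / A) ≤ 2 * π * cot α :=
      (log_le_iff_le_exp (div_pos hF hA)).2 ((div_le_iff₀' hA).2 hle)
    calc tan α * log (F₀ α A l / A) ≤ tan α * (2 * π * cot α) :=
          mul_le_mul_of_nonneg_left h1 htan.le
      _ = 2 * π := by rw [← mul_assoc, htc]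
  have key := h.spiral₀ _ hψ
  rw [hexp, mul_div_cancel₀ _ hA.ne'] at key
  have hl' : A / cos α * (F₀ α A l / A - 1) = l := by
    rw [F₀]
    field_simp
    ring
  rw [hl'] at key
  rw [F₀_zero, zero_add, key]

theorem apply_zero (h : IsBarrier α A M γ T τ) (hα : α ∈ Ioo 0 (π / 2)) (hA : 0 < A) :
    γ 0 = A := by
  have := h.eq_on_first_piece hα hA 0 ⟨le_rfl, (len₁_pos hα hA).le⟩
  rw [this, div_self (F₀_pos hα hA le_rfl).ne', F₀_zero]
  simp

theorem eq_on_second_piece (h : IsBarrier α A M γ T τ) (hα : α ∈ Ioo 0 (π / 2)) (hA : 0 < A) :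
    ∀ l ∈ Icc (len₁ α A) (len₂ α A), γ l = A + φ₀ α l *
      Complex.exp ((tan α * log (φ₀ α l / φ₀ α (len₁ α A)) : ℝ) * Complex.I) := by
  intro l hl
  have hc := cos_pos_of_mem hα
  have hs := sin_pos_of_mem hα
  have hl1 := len₁_pos hα hA
  have hl0 := hl1.trans_le hl.1
  have htan : 0 < tan α := tan_pos_of_pos_of_lt_pi_div_two hα.1 hα.2
  have htc : ∀ x : ℝ, tan α * x * cot α = x := fun x => by
    rw [tan_eq_sin_div_cos, cot_eq_cos_div_sin]; field_simp
  have hq : φ₀ α l / φ₀ α (len₁ α A) = l / len₁ α A := by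
    rw [φ₀, φ₀, mul_div_mul_left _ _ hc.ne']
  have hexp : exp (tan α * log (l / len₁ α A) * cot α) = l / len₁ α A := by
    rw [htc, exp_log (div_pos hl0 hl1)]
  have hψ : tan α * log (l / len₁ α A) ∈ Icc 0 α := by
    refine ⟨mul_nonneg htan.le (log_nonneg ((one_le_div hl1).2 hl.1)), ?_⟩
    have h1 : log (l / len₁ α A) ≤ α * cot α :=
      (log_le_iff_le_exp (div_pos hl0 hl1)).2 ((div_le_iff₀' hl1).2 hl.2)
    calc tan α * log (l / len₁ α A) ≤ tan α * (α * cot α) :=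
          mul_le_mul_of_nonneg_left h1 htan.le
      _ = α := by rw [← mul_assoc, htc]
  have key := h.spiral₁ _ hψ
  rw [hexp, mul_div_cancel₀ _ hl1.ne', ← φ₀_len₁ hα, φ₀, mul_assoc, mul_div_cancel₀ _ hl1.ne']
    at key
  rw [hq, key, φ₀]

theorem norm_eq_F₀ (h : IsBarrier α A M γ T τ) (hα : α ∈ Ioo 0 (π / 2)) (hA : 0 < A) {l : ℝ}
    (hl : l ∈ Icc 0 (len₁ α A)) : ‖γ l‖ = F₀ α A l := by
  rw [h.eq_on_first_piece hα hA l hl, zero_add, norm_mul, Complex.norm_exp_ofReal_mul_I, mul_one,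
    Complex.norm_of_nonneg (F₀_pos hα hA hl.1).le]

theorem norm_sub_eq_φ₀ (h : IsBarrier α A M γ T τ) (hα : α ∈ Ioo 0 (π / 2)) (hA : 0 < A) {l : ℝ}
    (hl : l ∈ Icc (len₁ α A) (len₂ α A)) : ‖γ l - γ 0‖ = φ₀ α l := by
  rw [h.eq_on_second_piece hα hA l hl, h.apply_zero hα hA, add_sub_cancel_left, norm_mul,
    Complex.norm_exp_ofReal_mul_I, mul_one,
    Complex.norm_of_nonneg (φ₀_pos hα ((len₁_pos hα hA).trans_le hl.1)).le]

theorem hasDerivWithinAt_T_first (h : IsBarrier α A M γ T τ) (hα : α ∈ Ioo 0 (π / 2))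
    (hA : 0 < A) : ∀ l ∈ Icc 0 (len₁ α A), HasDerivWithinAt T
      (Complex.I * (sin α / F₀ α A l : ℝ) * T l) (Icc 0 (len₁ α A)) l := by
  have hsub : Icc 0 (len₁ α A) ⊆ Icc 0 M :=
    Icc_subset_Icc_right ((len₁_lt_len₂ hα hA).le.trans h.len₂_le)
  exact hasDerivWithinAt_tangent_of_spiral (len₁_pos hα hA) (cos_pos_of_mem hα).ne'
    (hasDerivAt_F₀ α A) (fun l hl => F₀_pos hα hA hl.1) (h.eq_on_first_piece hα hA)
    fun l hl => (h.hasDeriv l (hsub hl)).mono hsub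

theorem hasDerivWithinAt_T_second (h : IsBarrier α A M γ T τ) (hα : α ∈ Ioo 0 (π / 2))
    (hA : 0 < A) : ∀ l ∈ Icc (len₁ α A) (len₂ α A), HasDerivWithinAt T
      (Complex.I * (sin α / φ₀ α l : ℝ) * T l) (Icc (len₁ α A) (len₂ α A)) l := by
  have hsub : Icc (len₁ α A) (len₂ α A) ⊆ Icc 0 M :=
    Icc_subset_Icc (len₁_pos hα hA).le h.len₂_le
  exact hasDerivWithinAt_tangent_of_spiral (len₁_lt_len₂ hα hA) (cos_pos_of_mem hα).ne'
    (hasDerivAt_φ₀ α) (fun l hl => φ₀_pos hα ((len₁_pos hα hA).trans_le hl.1))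
    (h.eq_on_second_piece hα hA) fun l hl => (h.hasDeriv l (hsub hl)).mono hsub

/-! ### The free string lengths -/

/-- The linkage starting at `0` is the one starting at `l₂` preceded by the segment `p₀ p₂`. -/
theorem stringLen_succ_zero (h : IsBarrier α A M γ T τ) (hα : α ∈ Ioo 0 (π / 2)) (hA : 0 < A)
    (j : ℕ) : stringLen γ (outerEnd α A M τ) (F₀ α A) (j + 1) 0 =
      stringLen γ (outerEnd α A M τ) (φ₀ α) j (len₂ α A) := by
  rw [stringLen, Function.iterate_succ_apply, h.outerEnd_zero hα hA]
  cases j with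
  | zero =>
    rw [Function.iterate_zero_apply, Function.iterate_zero_apply, stringLen]
    exact h.norm_sub_eq_φ₀ hα hA ⟨(len₁_lt_len₂ hα hA).le, le_rfl⟩
  | succ j => rw [stringLen, Function.iterate_succ_apply _ j 0, h.outerEnd_zero hα hA]

/-- Both sides satisfy the same integral recursion, with the same initial values at `0` and `l₁`. As
the linkages starting before `l` reach as far as the one starting at `l`, only strings that exist
enter the integrals. -/
theorem stringLen_eq (h : IsBarrier α A M γ T τ) (hα : α ∈ Ioo 0 (π / 2)) (hA : 0 < A) (j : ℕ) :
    (∀ l ∈ Icc 0 (len₁ α A), l ∈ reach α A M τ j →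
      stringLen γ (outerEnd α A M τ) (F₀ α A) j l = F α A j l) ∧
    (∀ l ∈ Icc (len₁ α A) (len₂ α A), l ∈ reach α A M τ j →
      stringLen γ (outerEnd α A M τ) (φ₀ α) j l = φ α A j l) := by
  induction j with
  | zero => exact ⟨fun l _ _ => rfl, fun l _ _ => rfl⟩
  | succ j ih =>
    have hl1 := len₁_pos hα hA
    have hl12 := len₁_lt_len₂ hα hA
    have hfirst : ∀ l ∈ Icc 0 (len₁ α A), l ∈ reach α A M τ (j + 1) →
        stringLen γ (outerEnd α A M τ) (F₀ α A) (j + 1) l = F α A (j + 1) l := by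
      intro l hl hr
      have hsub : Icc 0 l ⊆ Icc 0 (len₁ α A) := Icc_subset_Icc_right hl.2
      have h2 : len₂ α A ∈ reach α A M τ j := by
        refine ⟨hl1.le.trans hl12.le, fun i hi => ?_⟩
        rw [← h.outerEnd_zero hα hA, ← Function.iterate_succ_apply]
        exact (h.mem_reach_of_le hα hA le_rfl hl.1 hr).2 (i + 1) (by omega)
      rw [h.stringLen_succ_eq hα hA (hasDerivAt_F₀ α A) le_rfl hl.1
        (hl.2.trans (hl12.le.trans h.len₂_le)) hr (fun t ht => F₀_pos hα hA ht.1)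
        (fun t ht => (h.hasDerivWithinAt_T_first hα hA t (hsub ht)).mono hsub),
        h.stringLen_succ_zero hα hA, ih.2 _ ⟨hl12.le, le_rfl⟩ h2, F_succ]
      congr 2
      refine intervalIntegral.integral_congr fun t ht => ?_
      rw [uIcc_of_le hl.1] at ht
      simp only [F_zero_eq]
      rw [ih.1 t (hsub ht) (reach_anti j.le_succ (h.mem_reach_of_le hα hA ht.1 ht.2 hr))]
    refine ⟨hfirst, fun l hl hr => ?_⟩
    have hsub : Icc (len₁ α A) l ⊆ Icc (len₁ α A) (len₂ α A) := Icc_subset_Icc_right hl.2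
    have h1 : stringLen γ (outerEnd α A M τ) (φ₀ α) (j + 1) (len₁ α A) =
        F α A (j + 1) (len₁ α A) :=
      hfirst _ ⟨hl1.le, le_rfl⟩ (h.mem_reach_of_le hα hA hl1.le hl.1 hr)
    rw [h.stringLen_succ_eq hα hA (hasDerivAt_φ₀ α) hl1.le hl.1 (hl.2.trans h.len₂_le) hr
      (fun t ht => φ₀_pos hα (hl1.trans_le ht.1))
      (fun t ht => (h.hasDerivWithinAt_T_second hα hA t (hsub ht)).mono hsub), h1, φ_succ]
    congr 2
    refine intervalIntegral.integral_congr fun t ht => ?_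
    rw [uIcc_of_le hl.1] at ht
    simp only [φ_zero_eq]
    rw [ih.2 t (hsub ht) (reach_anti j.le_succ
      (h.mem_reach_of_le hα hA (hl1.le.trans ht.1) ht.2 hr))]

end IsBarrier

theorem angle_mem {V : ℝ} (hV : 1 < V) : angle V ∈ Ioo 0 (π / 2) :=
  ⟨arccos_pos.2 ((div_lt_one (by linarith)).2 hV), arccos_lt_pi_div_two.2 (by positivity)⟩

end Firefighter

open Firefighter in
theorem mainTheorem2 (V A : ℝ) (hV : 1 < V) (hA : 0 < A) :
    -- the recursively given `F_j(l)`, `φ_j(l)` are the free string lengths of the barrier curve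
    (∀ (M : ℝ) (γ T : ℝ → ℂ) (τ : ℝ → ℝ), IsBarrier (angle V) A M γ T τ →
      (∀ l ∈ Set.Icc 0 (len₁ (angle V) A), ‖γ l‖ = F (angle V) A 0 l) ∧
      (∀ l ∈ Set.Icc (len₁ (angle V) A) (len₂ (angle V) A), ‖γ l - γ 0‖ = φ (angle V) A 0 l) ∧
      ∀ (ℓ : ℕ → ℝ) (j : ℕ), IsLinkage (angle V) A M τ ℓ (j + 1) →
        (ℓ 0 ∈ Set.Icc 0 (len₁ (angle V) A) →
          ‖γ (ℓ (j + 1)) - γ (ℓ j)‖ = F (angle V) A (j + 1) (ℓ 0)) ∧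
        (ℓ 0 ∈ Set.Icc (len₁ (angle V) A) (len₂ (angle V) A) →
          ‖γ (ℓ (j + 1)) - γ (ℓ j)‖ = φ (angle V) A (j + 1) (ℓ 0))) ∧
    -- the generating function identity, as formal power series
    PowerSeries.mk (fun j => roundEnd (angle V) A j / roundEnd (angle V) A 0) *
        (PowerSeries.rescale (w (angle V)) (PowerSeries.exp ℝ)
          - PowerSeries.C (s (angle V)) * PowerSeries.X) =
      PowerSeries.rescale (v (angle V)) (PowerSeries.exp ℝ)
        - PowerSeries.C (r (angle V)) * PowerSeries.X ∧
    -- the generating function identity, as functions, on each disc free of zeros of the denominator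
    (∀ R : ℝ,
      (∀ u : ℂ, ‖u‖ < R → Complex.exp (w (angle V) * u) - s (angle V) * u ≠ 0) →
      ∀ Z : ℂ, ‖Z‖ < R →
        HasSum (fun j : ℕ => ((roundEnd (angle V) A j / roundEnd (angle V) A 0 : ℝ) : ℂ) * Z ^ j)
          ((Complex.exp (v (angle V) * Z) - r (angle V) * Z) /
            (Complex.exp (w (angle V) * Z) - s (angle V) * Z))) := by
  have hα := angle_mem hV
  have hmul := mk_roundEnd_mul hα hA
  refine ⟨fun M γ T τ h => ⟨fun l hl => h.norm_eq_F₀ hα hA hl,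
    fun l hl => h.norm_sub_eq_φ₀ hα hA hl, fun ℓ j hℓ => ?_⟩, hmul,
    fun R hne Z hZ => hasSum_of_mul_exp_sub_linear hmul hne hZ⟩
  have hσ := h.iterate_eq_of_isLinkage hα hA hℓ
  rw [← hσ (j + 1) le_rfl, ← hσ j j.le_succ]
  exact ⟨fun h0 => (h.stringLen_eq hα hA (j + 1)).1 _ h0
      (h.mem_reach_of_isLinkage hα hA hℓ h0.1),
    fun h0 => (h.stringLen_eq hα hA (j + 1)).2 _ h0
      (h.mem_reach_of_isLinkage hα hA hℓ ((len₁_pos hα hA).le.trans h0.1))⟩
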